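/- Let $(V,\circ,u,\langle\cdot,\cdot\rangle)$ be a Euclidean Jordan algebra: a finite-dimensional real inner product space with a commutative bilinear product $\circ$ with unit $u$ such that $x^2\circ(x\circ y)=x\circ(x^2\circ y)$ and $\langle x\circ y,z\rangle=\langle x,y\circ z\rangle$ for all $x,y,z\in V$, where $x^2=x\circ x$. (The inner product need not be normalized; the usual normalization $\langle c,u\rangle=1$ for all primitive idempotents $c$ is a special case.) Put $\operatorname{tr}x=\langle x,u\rangle$ and $P_x(y)=2\,x\circ(x\circ y)-x^2\circ y$. A state is an element $\rho=x^2$, $x\in V$, with $\operatorname{tr}\rho=1$. If $x=\sum_i\lambda_ic_i$ is the spectral decomposition of $x$ (distinct real numbers $\lambda_i$, non-zero idempotents $c_i$ with $c_i\circ c_j=0$ for $i\ne j$ and $\sum_ic_i=u$), put $f(x)=\sum_if(\lambda_i)c_i$; in particular this defines $x^t$ for $x$ in the cone of squares, where for $t<0$ the sum runs only over the $i$ with $\lambda_i\neq0$. The support of $x$ is the idempotent $\operatorname{supp}x=\sum_{\lambda_i\ne0}c_i$, and the support of $\rho$ is contained in that of $\sigma$ if $(\operatorname{supp}\sigma)\circ\rho=\rho$;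 this always holds if $0$ is not an eigenvalue of $\sigma$. For states $\rho,\sigma$ and real $s>0$ define the Petz and the sandwiched relative Rényi entropy by $$D_{1+s}(\rho\|\sigma)=\frac1s\log\operatorname{tr}\bigl(\rho^{1+s}\circ\sigma^{-s}\bigr),\qquad \underline D_{1+s}(\rho\|\sigma)=\frac1s\log\operatorname{tr}\Bigl(\bigl(P_{\sigma^{-s/(2(1+s))}}(\rho)\bigr)^{1+s}\Bigr)$$ if the support of $\rho$ is contained in that of $\sigma$, and by $+\infty$ for both otherwise. Then for all states $\rho,\sigma$ in $V$ and all real $s>0$, $$D_{1+s}(\rho\|\sigma)\;\ge\;\underline D_{1+s}(\rho\|\sigma).$$ -/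

import Mathlib

/-- A (unital) Euclidean Jordan algebra: a finite-dimensional real vector space `V` with a
commutative, bilinear, unital product `*` satisfying the Jordan identity (`IsCommJordan`), and with
an inner product `form` that is associative for the product. No normalization of `form` is imposed;
the inner products with `⟨c, 1⟩ = 1` for every primitive idempotent `c`, for which `tr` below is the
canonical trace, are a special case. -/
class EuclideanJordanAlgebra (V : Type*) [NonAssocCommRing V] [Module ℝ V] extends
    IsCommJordan V, IsScalarTower ℝ V V, SMulCommClass ℝ V V, Module.Finite ℝ V where
  /-- The inner product `⟨x, y⟩`. -/
  form : LinearMap.BilinForm ℝ V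
  form_symm : ∀ x y : V, form x y = form y x
  form_pos : ∀ x : V, x ≠ 0 → 0 < form x x
  form_assoc : ∀ x y z : V, form (x * y) z = form x (y * z)

namespace EuclideanJordanAlgebra

variable {V : Type*} [NonAssocCommRing V] [Module ℝ V]

/-- A complete system of orthogonal idempotents (with no zero member). -/
structure IsCSOI {ι : Type*} [Fintype ι] (c : ι → V) : Prop where
  idem : ∀ i, c i * c i = c i
  ne_zero : ∀ i, c i ≠ 0
  orth : ∀ i j, i ≠ j → c i * c j = 0
  complete : ∑ i, c i = 1

/-- A spectral decomposition `x = ∑ i, eigenvalue i • proj i`, with distinct eigenvalues and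
`proj` a complete system of orthogonal idempotents. -/
structure SpectralDecomposition (x : V) where
  d : ℕ
  eigenvalue : Fin d → ℝ
  proj : Fin d → V
  injective : Function.Injective eigenvalue
  csoi : IsCSOI proj
  eq_sum : x = ∑ i, eigenvalue i • proj i

/-- The value of `f` at `x` read off from one spectral decomposition of `x`. -/
def SpectralDecomposition.apply {x : V} (D : SpectralDecomposition x) (f : ℝ → ℝ) : V :=
  ∑ i, f (D.eigenvalue i) • D.proj i

open Classical in
/-- Functional calculus `f(x) = ∑ i, f (λ i) • c i`, where `x = ∑ i, λ i • c i` is the spectral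
decomposition of `x`. It exists for every element of a Euclidean Jordan algebra (spectral theorem),
so the last branch is never used there, and the value does not depend on the chosen decomposition
(`fn_eq_apply` below). -/
noncomputable def fn (f : ℝ → ℝ) (x : V) : V :=
  if h : Nonempty (SpectralDecomposition x) then h.some.apply f else 0

/-- Real powers `x ^ t` of a positive element. For `t ≠ 0` we have `(0 : ℝ) ^ t = 0`, so for `t < 0`
and singular `x` this is the power of `x` on its support. -/
noncomputable def pow (x : V) (t : ℝ) : V := fn (fun r => r ^ t) x

open Classical in
/-- The support idempotent of `x`: the sum of the spectral idempotents of `x` that belong to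
non-zero eigenvalues. It equals `1` when `0` is not an eigenvalue of `x`. -/
noncomputable def supp (x : V) : V := fn (fun r => if r = 0 then 0 else 1) x

/-- The support of `ρ` is contained in the support of `σ`. -/
def SuppLE (ρ σ : V) : Prop := supp σ * ρ = ρ

/-- The quadratic representation `P_x y = 2 x ∘ (x ∘ y) - x² ∘ y`. -/
def quad (x y : V) : V := (2 : ℝ) • (x * (x * y)) - (x * x) * y

section Euclidean

variable [EuclideanJordanAlgebra V]

/-- The trace `tr x = ⟨x, u⟩`, where `u = 1` is the unit. -/
def tr (x : V) : ℝ := form x 1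

/-- States: elements of the cone of squares with unit trace. -/
def IsState (ρ : V) : Prop := (∃ x : V, ρ = x * x) ∧ tr ρ = 1

open Classical in
/-- The Petz relative Rényi entropy `D_{1+s}(ρ‖σ) = (1/s) log tr (ρ^{1+s} ∘ σ^{-s})` (for `s > 0`),
equal to `+∞` when the support of `ρ` is not contained in that of `σ`. -/
noncomputable def petzRenyi (s : ℝ) (ρ σ : V) : EReal :=
  if SuppLE ρ σ then
    ((1 / s * Real.log (tr (pow ρ (1 + s) * pow σ (-s))) : ℝ) : EReal)
  else ⊤

open Classical in
/-- The sandwiched relative Rényi entropy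
`(1/s) log tr ((P_{σ^{-s/(2(1+s))}} ρ)^{1+s})` (for `s > 0`),
equal to `+∞` when the support of `ρ` is not contained in that of `σ`. -/
noncomputable def sandwichedRenyi (s : ℝ) (ρ σ : V) : EReal :=
  if SuppLE ρ σ then
    ((1 / s * Real.log (tr (pow (quad (pow σ (-s / (2 * (1 + s)))) ρ) (1 + s))) : ℝ) : EReal)
  else ⊤

open Polynomial in
theorem aeval_mulLeft_one {x : V} (D : SpectralDecomposition x) (p : ℝ[X]) :
    aeval (LinearMap.mulLeft ℝ x) p 1 = ∑ i, p.eval (D.eigenvalue i) • D.proj i := by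
  induction p using Polynomial.induction_on' with
  | add p q hp hq => simp [hp, hq, add_smul, Finset.sum_add_distrib]
  | monomial n a =>
    have key : ((LinearMap.mulLeft ℝ x) ^ n) 1 = ∑ i, (D.eigenvalue i ^ n) • D.proj i := by
      induction n with
      | zero => simp [D.csoi.complete]
      | succ n ih =>
        rw [pow_succ', Module.End.mul_apply, ih, LinearMap.mulLeft_apply]
        refine (congrArg (fun y => y * ∑ i, D.eigenvalue i ^ n • D.proj i) D.eq_sum).trans ?_
        rw [Finset.sum_mul_sum]
        refine Finset.sum_congr rfl fun i _ => ?_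
        rw [Finset.sum_eq_single i]
        · rw [smul_mul_smul_comm, D.csoi.idem, pow_succ']
        · intro j _ hj
          rw [smul_mul_smul_comm, D.csoi.orth i j hj.symm, smul_zero]
        · simp
    rw [← C_mul_X_pow_eq_monomial]
    simp [key, mul_smul, smul_comm a]

/-- The functional calculus does not depend on the spectral decomposition. -/
theorem fn_eq_apply {x : V} (D : SpectralDecomposition x) (f : ℝ → ℝ) : fn f x = D.apply f := by
  have h : Nonempty (SpectralDecomposition x) := ⟨D⟩
  rw [fn, dif_pos h]
  classical
  set E := h.some
  set S : Finset ℝ := Finset.univ.image D.eigenvalue ∪ Finset.univ.image E.eigenvalue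
  have hp : ∀ r ∈ S, (Lagrange.interpolate S id f).eval r = f r := fun r hr =>
    Lagrange.eval_interpolate_at_node f (Set.injOn_id _) hr
  have hD := aeval_mulLeft_one D (Lagrange.interpolate S id f)
  have hE := aeval_mulLeft_one E (Lagrange.interpolate S id f)
  have h1 : D.apply f =
      ∑ i, (Lagrange.interpolate S id f).eval (D.eigenvalue i) • D.proj i :=
    Finset.sum_congr rfl fun i _ => by rw [hp _ (by simp [S])]
  have h2 : E.apply f =
      ∑ i, (Lagrange.interpolate S id f).eval (E.eigenvalue i) • E.proj i :=
    Finset.sum_congr rfl fun i _ => by rw [hp _ (by simp [S])]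
  rw [h1, h2, ← hD, ← hE]

/-- If `0` is not an eigenvalue of `σ`, every `ρ` has support contained in that of `σ`. -/
theorem suppLE_of_ne_zero {σ : V} (D : SpectralDecomposition σ) (h : ∀ i, D.eigenvalue i ≠ 0)
    (ρ : V) : SuppLE ρ σ := by
  have : supp σ = 1 := by
    rw [supp, fn_eq_apply D, SpectralDecomposition.apply, ← D.csoi.complete]
    exact Finset.sum_congr rfl fun i _ => by simp [h i]
  rw [SuppLE, this, one_mul]

end Euclidean

end EuclideanJordanAlgebra

/-! The comparison reduces to the Araki–Lieb–Thirring inequality `tr (P_a b)^r ≤ tr (P_{a^r} b^r)`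
for squares `a`, `b` and `1 ≤ r`, applied to `a = σ^{-s/(2(1+s))}`, `b = ρ` and `r = 1 + s`.

In the complexification of `V`, write `a = ∑ αᵢ cᵢ`, `b = ∑ βⱼ dⱼ` and `P_a b = ∑ ξₗ eₗ`, and
replace the eigenvalues by complex powers. The function `z ↦ ⟨(P_a b)^{r-z}, P_{a^z} b^z⟩` takes the
value `tr (P_a b)^r` at `z = 1`. On `re z = 0` the elements `a^z` and `b^z` are unitary on their
supports; by the fundamental formula `P_{P_x y} = P_x P_y P_x`, `P_x` maps unitary elements to
unitary ones if `x` is unitary, and with the maximum principle on the supports this bounds the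
function by `tr (P_a b)^r`. On `re z = r` the same argument with one factor `P_{a^r}` moved to the
other side gives the bound `tr (P_{a^r} b^r)`. The three lines theorem interpolates between the two
bounds. -/

namespace EuclideanJordanAlgebra

section Jordan

variable {V : Type*} [NonAssocCommRing V]

/-- The Jordan triple product `{x, y, z}`, normalized so that `{x, y, x} = P_x y`. -/
def triple (x y z : V) : V := (x * y) * z + (z * y) * x - (x * z) * y

theorem triple_comm (x y z : V) : triple x y z = triple z y x := by
  rw [triple, triple, mul_comm x z]; abel

theorem triple_eq_mul_add_commutator (x y z : V) :
    triple x y z = (x * y) * z + (x * (y * z) - y * (x * z)) := by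
  rw [triple, mul_comm z y, mul_comm (y * z), mul_comm (x * z)]
  abel

variable [IsCommJordan V] [IsAddTorsionFree V]

theorem jordan_linearized (x y z w : V) :
    x * ((y * z) * w) + y * ((z * x) * w) + z * ((x * y) * w) =
      (y * z) * (x * w) + (z * x) * (y * w) + (x * y) * (z * w) := by
  have h : 2 • ((x * ((y * z) * w) - (y * z) * (x * w)) +
      (y * ((z * x) * w) - (z * x) * (y * w)) +
      (z * ((x * y) * w) - (x * y) * (z * w))) = 0 :=
    DFunLike.congr_fun (two_nsmul_lie_lmul_lmul_add_add_eq_zero x y z) w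
  rw [← sub_eq_zero, ← (smul_eq_zero.1 h).resolve_left two_ne_zero]
  abel

theorem mul_triple (a u v w : V) :
    a * triple u v w = triple (a * u) v w - triple u (a * v) w + triple u v (a * w) := by
  have h1 := jordan_linearized a u v w
  have h2 := jordan_linearized a v w u
  have h3 := jordan_linearized a u w v
  simp only [triple, mul_sub, mul_add]
  simp only [mul_comm] at h1 h2 h3 ⊢
  grind

theorem commutator_triple (x y u v w : V) :
    x * (y * triple u v w) - y * (x * triple u v w) =
      triple (x * (y * u) - y * (x * u)) v w + triple u (x * (y * v) - y * (x * v)) w +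
        triple u v (x * (y * w) - y * (x * w)) := by
  simp only [mul_triple, mul_add, mul_sub]
  simp only [triple, mul_sub, sub_mul]
  abel

theorem triple_triple (x y u v w : V) :
    triple x y (triple u v w) =
      triple (triple x y u) v w - triple u (triple y x v) w + triple u v (triple x y w) := by
  rw [triple_eq_mul_add_commutator x y (triple u v w), mul_triple, commutator_triple]
  simp only [triple_eq_mul_add_commutator x y u, triple_eq_mul_add_commutator y x v,
    triple_eq_mul_add_commutator x y w, mul_comm y x]
  simp only [triple, mul_sub, sub_mul, mul_add, add_mul]
  abel

theorem triple_triple_self (x y v : V) :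
    triple x y (triple x v x) = triple x (triple y x v) x := by
  have h1 := triple_triple x y x v x
  have h2 := triple_triple x v x y x
  have e1 := triple_comm x v (triple x y x)
  have e2 := triple_comm x y (triple x v x)
  have e3 := triple_comm v x y
  grind

theorem triple_fundamental (x y z : V) :
    triple (triple x y x) z (triple x y x) = triple x (triple y (triple x z x) y) x := by
  have h1 := triple_triple x y x z (triple x y x)
  have h2 := triple_triple z x y x y
  rw [triple_triple_self x z, triple_triple_self x y, triple_triple_self x (triple y x z),
    triple_triple_self x y, triple_triple_self x z] at h1
  rw [triple_comm y x (triple z x y)] at h2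
  have hadd (a b : V) : triple x (a + b) x = triple x a x + triple x b x := by
    simp only [triple, mul_add, add_mul]; abel
  have h3 : triple x (triple z x (triple y x y)) x =
      triple x (triple (triple z x y) x y) x + triple x (triple (triple z x y) x y) x -
        triple x (triple y (triple x z x) y) x := by
    rw [h2, eq_sub_iff_add_eq, ← hadd, ← hadd]
    congr 1; abel
  rw [triple_comm (triple y x z), triple_comm y x z] at h1
  rw [triple_comm (triple z x y) x y] at h3
  grind

end Jordan

section QuadraticRepresentation

variable {V : Type*} [NonAssocCommRing V] [Module ℝ V]

theorem quad_eq_triple (x y : V) : quad x y = triple x y x := by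
  rw [quad, triple, two_smul, mul_comm x (x * y)]

theorem quad_one (x : V) : quad x 1 = x * x := by
  simp [quad, two_smul]

theorem quad_quad [IsCommJordan V] (x y z : V) :
    quad (quad x y) z = quad x (quad y (quad x z)) := by
  have : IsAddTorsionFree V := .of_isTorsionFree ℝ V
  simp only [quad_eq_triple, triple_fundamental]

variable [SMulCommClass ℝ V V]

/-- The quadratic representation `P_x` as a linear map. -/
noncomputable def quadRep (x : V) : Module.End ℝ V :=
  (2 : ℝ) • (LinearMap.mulLeft ℝ x * LinearMap.mulLeft ℝ x) - LinearMap.mulLeft ℝ (x * x)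

theorem quadRep_apply (x y : V) : quadRep x y = quad x y := rfl

theorem quadRep_one : quadRep (1 : V) = 1 := by
  ext y
  simp [quadRep_apply, quad, two_smul]

variable [IsCommJordan V]

theorem quadRep_quad (x y : V) : quadRep (quad x y) = quadRep x * quadRep y * quadRep x :=
  LinearMap.ext (quad_quad x y)

theorem commute_mulLeft_mulLeft_mul_self (x : V) :
    Commute (LinearMap.mulLeft ℝ x) (LinearMap.mulLeft ℝ (x * x)) :=
  LinearMap.ext fun y => DFunLike.congr_fun (commute_lmul_lmul_sq x).eq y

theorem commute_mulLeft_quadRep (x : V) : Commute (LinearMap.mulLeft ℝ x) (quadRep x) :=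
  (((Commute.refl _).mul_right (Commute.refl _)).smul_right _).sub_right
    (commute_mulLeft_mulLeft_mul_self x)

/-- `y` is the inverse of `x` in the Jordan sense, expressed by the quadratic representation. -/
def IsJordanInverse (x y : V) : Prop := quad x y = x ∧ quad x (y * y) = 1

theorem IsJordanInverse.isUnit_quadRep {x y : V} (h : IsJordanInverse x y) :
    IsUnit (quadRep x) := by
  have h1 : quadRep x * (quadRep (y * y) * quadRep x) = 1 := by
    rw [← mul_assoc, ← quadRep_quad, h.2, quadRep_one]
  have h2 : (quadRep x * quadRep (y * y)) * quadRep x = 1 := by rw [mul_assoc, h1]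
  exact ⟨⟨_, _, h1, by rwa [← left_inv_eq_right_inv h2 h1]⟩, rfl⟩

theorem IsJordanInverse.quad_quad_cancel {x y : V} (h : IsJordanInverse x y) (z : V) :
    quad x (quad y z) = z := by
  have hmul : quadRep x * quadRep y = 1 :=
    h.isUnit_quadRep.mul_right_cancel (by rw [← quadRep_quad, h.1, one_mul])
  exact LinearMap.congr_fun hmul z

theorem IsJordanInverse.quad_injective {x y : V} (h : IsJordanInverse x y) :
    Function.Injective (quad x) :=
  ((Module.End.isUnit_iff _).1 h.isUnit_quadRep).injective

theorem IsJordanInverse.mul_eq_one {x y : V} (h : IsJordanInverse x y) : x * y = 1 := by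
  apply h.quad_injective
  calc quad x (x * y) = x * quad x y :=
        (LinearMap.congr_fun (commute_mulLeft_quadRep x).eq y).symm
    _ = quad x 1 := by rw [h.1, quad_one]

protected theorem IsJordanInverse.quad {x y x' y' : V} (h : IsJordanInverse x y)
    (h' : IsJordanInverse x' y') : IsJordanInverse (quad x x') (quad y y') := by
  constructor
  · rw [quad_quad, h.quad_quad_cancel, h'.1]
  · rw [← quad_one, quad_quad y, quad_quad x, h.quad_quad_cancel, h'.quad_quad_cancel,
      h.quad_quad_cancel]

end QuadraticRepresentation

section PowerAssociativity

open Polynomial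

variable {V : Type*} [NonAssocCommRing V] [Module ℝ V] [IsCommJordan V] [SMulCommClass ℝ V V]

theorem mulLeft_mul_mul (x y : V) :
    LinearMap.mulLeft ℝ (x * (x * y)) =
      LinearMap.mulLeft ℝ (x * x) * LinearMap.mulLeft ℝ y +
        (2 : ℝ) • (LinearMap.mulLeft ℝ (x * y) * LinearMap.mulLeft ℝ x) -
        LinearMap.mulLeft ℝ x * LinearMap.mulLeft ℝ x * LinearMap.mulLeft ℝ y -
        LinearMap.mulLeft ℝ y * LinearMap.mulLeft ℝ x * LinearMap.mulLeft ℝ x := by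
  have : IsAddTorsionFree V := .of_isTorsionFree ℝ V
  ext v
  have h := jordan_linearized x y v x
  simp only [two_smul, LinearMap.sub_apply, LinearMap.add_apply, Module.End.mul_apply,
    LinearMap.mulLeft_apply]
  simp only [mul_comm] at h ⊢
  grind

theorem commute_mulLeft_mulLeft_pow (x : V) (n : ℕ) :
    Commute (LinearMap.mulLeft ℝ x) (LinearMap.mulLeft ℝ ((LinearMap.mulLeft ℝ x ^ n) 1)) := by
  induction n using Nat.twoStepInduction with
  | zero =>
    rw [pow_zero, Module.End.one_apply, LinearMap.mulLeft_one]
    exact Commute.one_right _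
  | one => simp
  | more n h0 h1 =>
    rw [pow_succ', pow_succ'] at *
    simp only [Module.End.mul_apply, LinearMap.mulLeft_apply] at *
    rw [mulLeft_mul_mul]
    have hx := Commute.refl (LinearMap.mulLeft ℝ x)
    exact ((((commute_mulLeft_mulLeft_mul_self x).mul_right h0).add_right
      ((h1.mul_right hx).smul_right _)).sub_right ((hx.mul_right hx).mul_right h0)).sub_right
      ((h0.mul_right hx).mul_right hx)

variable [IsScalarTower ℝ V V]

theorem commute_mulLeft_mulLeft_aeval (x : V) (p : ℝ[X]) :
    Commute (LinearMap.mulLeft ℝ x) (LinearMap.mulLeft ℝ (aeval (LinearMap.mulLeft ℝ x) p 1)) := by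
  change Commute _ (LinearMap.mul ℝ V _)
  rw [aeval_eq_sum_range, LinearMap.sum_apply, map_sum]
  refine Commute.sum_right _ _ _ fun n _ => ?_
  rw [LinearMap.smul_apply, map_smul]
  exact (commute_mulLeft_mulLeft_pow x n).smul_right _

theorem aeval_mulLeft_mul (x : V) (p q : ℝ[X]) :
    aeval (LinearMap.mulLeft ℝ x) (p * q) 1 =
      aeval (LinearMap.mulLeft ℝ x) p 1 * aeval (LinearMap.mulLeft ℝ x) q 1 := by
  have h : Commute (aeval (LinearMap.mulLeft ℝ x) q)
      (LinearMap.mulLeft ℝ (aeval (LinearMap.mulLeft ℝ x) p 1)) := by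
    rw [aeval_eq_sum_range]
    exact Commute.sum_left _ _ _ fun n _ =>
      ((commute_mulLeft_mulLeft_aeval x p).pow_left n).smul_left _
  simpa [mul_comm p q] using LinearMap.congr_fun h.eq 1

end PowerAssociativity

section Diagonal

variable {𝕜 W ι : Type*} [CommRing 𝕜] [NonAssocCommRing W] [Module 𝕜 W] [Fintype ι]

/-- The element `∑ i, z i • c i` with eigenvalues `z` along the frame `c`. The scalars need not be
real, so that the same notation serves the complexification. -/
def diag (c : ι → W) (z : ι → 𝕜) : W := ∑ i, z i • c i

theorem diag_single [DecidableEq ι] (c : ι → W) (i : ι) : diag c (Pi.single i (1 : 𝕜)) = c i := by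
  simp [diag, Pi.single_apply]

theorem diag_add (c : ι → W) (z w : ι → 𝕜) : diag c (z + w) = diag c z + diag c w := by
  simp [diag, add_smul, Finset.sum_add_distrib]

theorem diag_smul (c : ι → W) (a : 𝕜) (z : ι → 𝕜) : diag c (a • z) = a • diag c z := by
  simp [diag, mul_smul, Finset.smul_sum]

variable {c : ι → W} (hc : IsCSOI c)
include hc

theorem diag_one : diag c (1 : ι → 𝕜) = 1 := by
  simp [diag, hc.complete]

variable [IsScalarTower 𝕜 W W] [SMulCommClass 𝕜 W W]

theorem diag_mul_diag (z w : ι → 𝕜) : diag c z * diag c w = diag c (z * w) := by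
  rw [diag, diag, Finset.sum_mul_sum]
  refine Finset.sum_congr rfl fun i _ => ?_
  rw [Finset.sum_eq_single i]
  · rw [smul_mul_smul_comm, hc.idem, Pi.mul_apply]
  · intro j _ hj
    rw [smul_mul_smul_comm, hc.orth i j hj.symm, smul_zero]
  · simp

open Polynomial in
theorem aeval_mulLeft_diag (z : ι → 𝕜) (p : 𝕜[X]) :
    aeval (LinearMap.mulLeft 𝕜 (diag c z)) p 1 = diag c fun i => p.eval (z i) := by
  have hpow (n : ℕ) : (LinearMap.mulLeft 𝕜 (diag c z) ^ n) 1 = diag c (z ^ n) := by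
    induction n with
    | zero => rw [pow_zero, pow_zero, Module.End.one_apply, diag_one hc]
    | succ n ih =>
      rw [pow_succ', pow_succ', Module.End.mul_apply, ih, LinearMap.mulLeft_apply,
        diag_mul_diag hc]
  rw [aeval_eq_sum_range, LinearMap.sum_apply]
  simp only [LinearMap.smul_apply, hpow, ← diag_smul]
  simp only [diag, eval_eq_sum_range, Finset.sum_smul, Pi.smul_apply, Pi.pow_apply, smul_eq_mul]
  exact Finset.sum_comm

variable [Module ℝ W]

omit hc [IsScalarTower 𝕜 W W] in
theorem quad_diag_right (x : W) (c : ι → W) (z : ι → 𝕜) :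
    quad x (diag c z) = diag (fun i => quad x (c i)) z := by
  simp only [quad, diag, two_smul, Finset.mul_sum, mul_smul_comm, smul_sub, smul_add,
    Finset.sum_sub_distrib, Finset.sum_add_distrib]

theorem quad_diag_diag (z w : ι → 𝕜) : quad (diag c z) (diag c w) = diag c (z * z * w) := by
  rw [quad, diag_mul_diag hc, diag_mul_diag hc, diag_mul_diag hc, diag_mul_diag hc, two_smul,
    mul_assoc, add_sub_cancel_right]

theorem isJordanInverse_diag {z w : ι → 𝕜} (h : z * w = 1) :
    IsJordanInverse (diag c z) (diag c w) := by
  constructor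
  · rw [quad_diag_diag hc, mul_assoc, h, mul_one]
  · rw [diag_mul_diag hc, quad_diag_diag hc, mul_mul_mul_comm, h, mul_one, diag_one hc]

variable [IsCommJordan W] [SMulCommClass ℝ W W]

theorem commute_mulLeft_diag (z w : ι → 𝕜) :
    Commute (LinearMap.mulLeft ℝ (diag c z)) (LinearMap.mulLeft ℝ (diag c w)) := by
  have : IsAddTorsionFree W := .of_isTorsionFree ℝ W
  have hproj (i j : ι) (y : W) : c i * (c j * y) = c j * (c i * y) := by
    by_cases hij : i = j
    · rw [hij]
    simpa only [hc.idem, hc.orth i j hij, hc.orth j i (Ne.symm hij), zero_mul, mul_zero,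
      add_zero] using jordan_linearized (c i) (c j) (c j) y
  ext y
  simp only [Module.End.mul_apply, LinearMap.mulLeft_apply, diag, Finset.sum_mul, Finset.mul_sum,
    smul_mul_assoc, mul_smul_comm, Finset.smul_sum]
  rw [Finset.sum_comm]
  refine Finset.sum_congr rfl fun i _ => Finset.sum_congr rfl fun j _ => ?_
  rw [hproj, smul_comm]

theorem commute_quadRep_diag (z w : ι → 𝕜) :
    Commute (quadRep (diag c z)) (quadRep (diag c w)) := by
  have h (z w : ι → 𝕜) : Commute (LinearMap.mulLeft ℝ (diag c z)) (quadRep (diag c w)) := by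
    rw [quadRep, diag_mul_diag hc]
    have hzw := commute_mulLeft_diag hc z w
    exact ((hzw.mul_right hzw).smul_right _).sub_right (commute_mulLeft_diag hc z _)
  rw [quadRep, diag_mul_diag hc]
  exact (((h z w).mul_left (h z w)).smul_left _).sub_left (h _ w)

theorem quad_diag_mul {z : ι → 𝕜} (hz : ∀ i, IsSquare (z i)) (w : ι → 𝕜) (y : W) :
    quad (diag c (z * w)) y = quad (diag c z) (quad (diag c w) y) := by
  choose u hu using hz
  obtain rfl : z = u * u := funext hu
  have hone (v : W) : quad 1 v = v := LinearMap.congr_fun quadRep_one v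
  calc quad (diag c (u * u * w)) y
      = quad (diag c u) (quad (diag c w) (quad (diag c u) y)) := by
        rw [← quad_diag_diag hc, quad_quad]
    _ = quad (diag c u) (quad (diag c u) (quad (diag c w) y)) :=
        congrArg _ (LinearMap.congr_fun (commute_quadRep_diag hc w u).eq y)
    _ = quad (diag c (u * u)) (quad (diag c w) y) := by
        rw [← diag_mul_diag hc, ← quad_one, quad_quad, hone]

end Diagonal

section Spectral

open Polynomial

variable {V : Type*} [NonAssocCommRing V] [Module ℝ V] [EuclideanJordanAlgebra V]

theorem form_self_nonneg (x : V) : 0 ≤ form x x := by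
  by_cases h : x = 0
  · simp [h]
  · exact (form_pos x h).le

theorem form_mul_left_comm (x y z : V) : form (x * y) z = form y (x * z) := by
  rw [mul_comm, form_assoc]

theorem exists_annihilating_finset (x : V) : ∃ S : Finset ℝ, ∀ p : ℝ[X],
    (∀ r ∈ S, p.eval r = 0) → aeval (LinearMap.mulLeft ℝ x) p = 0 := by
  classical
  let core : InnerProductSpace.Core ℝ V :=
    { inner := fun x y => form x y
      conj_inner_symm := fun x y => form_symm y x
      re_inner_nonneg := form_self_nonneg
      add_left := fun x y z => by simp
      smul_left := fun x y r => by simp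
      definite := fun x hx => not_imp_comm.1 (form_pos x) hx.not_gt }
  let _ : NormedAddCommGroup V := core.toNormedAddCommGroup
  let _ : InnerProductSpace ℝ V := InnerProductSpace.ofCore core.toCore
  have hsymm : (LinearMap.mulLeft ℝ x).IsSymmetric := form_mul_left_comm x
  refine ⟨Finset.univ.image (hsymm.eigenvalues rfl), fun p hp => ?_⟩
  refine (hsymm.eigenvectorBasis rfl).toBasis.ext fun i => ?_
  rw [OrthonormalBasis.coe_toBasis, Module.End.aeval_apply_of_hasEigenvector
    (hsymm.hasEigenvector_eigenvectorBasis rfl i), hp _ (by simp)]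
  simp

theorem exists_multiplicative_functionalCalculus (x : V) :
    ∃ (S : Finset ℝ) (E : (S → ℝ) →ₗ[ℝ] V),
      (∀ f g, E (f * g) = E f * E g) ∧ E 1 = 1 ∧ E Subtype.val = x := by
  classical
  obtain ⟨S, hS⟩ := exists_annihilating_finset x
  let interp : (S → ℝ) →ₗ[ℝ] ℝ[X] := Lagrange.interpolate Finset.univ Subtype.val
  have heval (f : S → ℝ) (r : S) : (interp f).eval (r : ℝ) = f r :=
    Lagrange.eval_interpolate_at_node f Subtype.val_injective.injOn (Finset.mem_univ r)
  have haeval {p q : ℝ[X]} (h : ∀ r : S, p.eval (r : ℝ) = q.eval (r : ℝ)) :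
      aeval (LinearMap.mulLeft ℝ x) p = aeval (LinearMap.mulLeft ℝ x) q := by
    rw [← sub_eq_zero, ← map_sub]
    exact hS _ fun r hr => by rw [eval_sub, h ⟨r, hr⟩, sub_self]
  refine ⟨S, LinearMap.applyₗ 1 ∘ₗ (aeval (LinearMap.mulLeft ℝ x)).toLinearMap ∘ₗ interp,
    fun f g => ?_, ?_, ?_⟩ <;>
    simp only [LinearMap.comp_apply, LinearMap.applyₗ_apply_apply, AlgHom.toLinearMap_apply]
  · rw [← aeval_mulLeft_mul, haeval fun r => ?_]
    rw [eval_mul, heval, heval, heval, Pi.mul_apply]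
  · rw [haeval (q := 1) fun r => ?_, aeval_one, Module.End.one_apply]
    rw [heval, eval_one, Pi.one_apply]
  · rw [haeval (q := X) fun r => ?_, aeval_X, LinearMap.mulLeft_apply, mul_one]
    rw [heval, eval_X]

theorem nonempty_spectralDecomposition (x : V) : Nonempty (SpectralDecomposition x) := by
  classical
  obtain ⟨S, E, hmul, hone, hval⟩ := exists_multiplicative_functionalCalculus x
  let v (r : S) : V := E (Pi.single r 1)
  have hidem (r : S) : v r * v r = v r := by rw [← hmul, ← Pi.single_mul, mul_one]
  have horth {r t : S} (hrt : r ≠ t) : v r * v t = 0 := by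
    rw [← hmul, ← map_zero E]
    congr 1; ext s; simp [Pi.single_apply]; grind
  have hsum (f : S → ℝ) : ∑ r, f r • v r = E f := by
    simp only [v, ← map_smul, ← map_sum]
    congr 1; ext s; simp [Pi.single_apply]
  let e := Fintype.equivFin {r // v r ≠ 0}
  have hinj : Function.Injective fun i => (e.symm i : S) :=
    Subtype.val_injective.comp e.symm.injective
  have hsum' (f : S → ℝ) : ∑ i, f (e.symm i) • v (e.symm i) = E f := by
    rw [← hsum, Fintype.sum_of_injective _ hinj _ (fun r => f r • v r) (fun r hr => ?_)
      fun i => rfl]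
    have hr0 : v r = 0 := by
      by_contra h
      exact hr ⟨e ⟨r, h⟩, by simp⟩
    rw [hr0, smul_zero]
  refine ⟨⟨_, fun i => (e.symm i : S), fun i => v (e.symm i), Subtype.val_injective.comp hinj,
    ⟨fun i => hidem _, fun i => (e.symm i).2, fun i j hij => horth (hinj.ne hij), ?_⟩, ?_⟩⟩
  · simpa [hone] using hsum' 1
  · rw [hsum' Subtype.val, hval]

theorem exists_eq_diag (x : V) :
    ∃ (n : ℕ) (c : Fin n → V) (z : Fin n → ℝ), IsCSOI c ∧ x = diag c z := by
  obtain ⟨D⟩ := nonempty_spectralDecomposition x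
  exact ⟨_, D.proj, D.eigenvalue, D.csoi, D.eq_sum⟩

variable {ι : Type*} [Fintype ι] {c : ι → V} (hc : IsCSOI c)
include hc

/-- Unlike in the definition of `fn`, the eigenvalues `z i` need not be distinct. -/
theorem fn_diag (f : ℝ → ℝ) (z : ι → ℝ) : fn f (diag c z) = diag c (f ∘ z) := by
  classical
  obtain ⟨D⟩ := nonempty_spectralDecomposition (diag c z)
  let S : Finset ℝ := Finset.univ.image z ∪ Finset.univ.image D.eigenvalue
  let p : ℝ[X] := Lagrange.interpolate S id f
  have hp {r : ℝ} (hr : r ∈ S) : p.eval r = f r :=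
    Lagrange.eval_interpolate_at_node f (Set.injOn_id _) hr
  calc fn f (diag c z) = ∑ i, p.eval (D.eigenvalue i) • D.proj i := by
        rw [fn_eq_apply D]
        exact Finset.sum_congr rfl fun i _ => by rw [hp (by simp [S])]
    _ = diag c fun i => p.eval (z i) := by
        rw [← aeval_mulLeft_one, aeval_mulLeft_diag hc]
    _ = diag c (f ∘ z) := congrArg (diag c) <| funext fun i => hp (by simp [S])

theorem pow_diag (z : ι → ℝ) (t : ℝ) : pow (diag c z) t = diag c fun i => z i ^ t :=
  fn_diag hc _ z

end Spectral

section Cone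

open Filter Topology

theorem peirce_polynomial {V : Type*} [NonAssocCommRing V] [IsCommJordan V] [IsAddTorsionFree V]
    {e : V} (he : e * e = e) (y : V) :
    2 • (e * (e * (e * y))) + e * y = 3 • (e * (e * y)) := by
  have h := jordan_linearized e y e e
  simp only [he, mul_comm y e, mul_comm (e * y) e] at h
  grind

variable {V : Type*} [NonAssocCommRing V] [Module ℝ V] [EuclideanJordanAlgebra V]

/-- `L = 8 (L - L²)² + (2 L² - L)²` modulo the Peirce polynomial `2 L³ - 3 L² + L`. -/
theorem form_idempotent_mul_self {e : V} (he : e * e = e) (y : V) :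
    form (e * y) y = 8 * form (e * y - e * (e * y)) (e * y - e * (e * y)) +
      form (2 • (e * (e * y)) - e * y) (2 • (e * (e * y)) - e * y) := by
  have : IsAddTorsionFree V := .of_isTorsionFree ℝ V
  have h1 := congrArg (form y) (peirce_polynomial he y)
  have h2 := congrArg (form y) (peirce_polynomial he (e * y))
  simp only [map_sub, map_add, map_nsmul, LinearMap.sub_apply,
    LinearMap.smul_apply, form_mul_left_comm e] at *
  simp only [nsmul_eq_mul, Nat.cast_ofNat] at *
  linarith

theorem form_idempotent_mul_self_nonneg {e : V} (he : e * e = e) (y : V) : 0 ≤ form e (y * y) := by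
  rw [← form_assoc, form_idempotent_mul_self he]
  have h1 := form_self_nonneg (e * y - e * (e * y))
  have h2 := form_self_nonneg (2 • (e * (e * y)) - e * y)
  positivity

theorem form_quad (x y z : V) : form (quad x y) z = form y (quad x z) := by
  simp only [quad, map_sub, map_smul, LinearMap.sub_apply, LinearMap.smul_apply, form_mul_left_comm]

theorem tr_mul (x y : V) : tr (x * y) = form x y := by
  rw [tr, form_assoc, mul_one]

theorem tr_quad (x y : V) : tr (quad x y) = tr (y * (x * x)) := by
  rw [tr, form_quad, quad_one, tr_mul]

theorem IsCSOI.tr_pos {ι : Type*} [Fintype ι] {c : ι → V} (hc : IsCSOI c) (i : ι) :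
    0 < tr (c i) := by
  rw [← hc.idem i, tr_mul]
  exact form_pos _ (hc.ne_zero i)

theorem form_diag {ι : Type*} [Fintype ι] (c : ι → V) (z : ι → ℝ) (y : V) :
    form (diag c z) y = ∑ i, z i * form (c i) y := by
  simp [diag]

theorem tr_diag {ι : Type*} [Fintype ι] (c : ι → V) (z : ι → ℝ) :
    tr (diag c z) = ∑ i, z i * tr (c i) := form_diag c z 1

section Frame

variable {ι : Type*} [Fintype ι] {c : ι → V} (hc : IsCSOI c) {z : ι → ℝ}
include hc

theorem form_diag_proj (z : ι → ℝ) (i : ι) : form (diag c z) (c i) = z i * tr (c i) := by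
  rw [form_diag, Finset.sum_eq_single i, ← tr_mul, hc.idem]
  · intro j _ hj
    rw [← tr_mul, hc.orth j i hj]
    simp [tr]
  · simp

theorem isSquare_diag (hz : ∀ i, 0 ≤ z i) : IsSquare (diag c z) := by
  refine ⟨diag c fun i => √(z i), ?_⟩
  rw [diag_mul_diag hc]
  exact congrArg (diag c) <| funext fun i => (Real.mul_self_sqrt (hz i)).symm

theorem form_diag_mul_self_nonneg (hz : ∀ i, 0 ≤ z i) (y : V) : 0 ≤ form (diag c z) (y * y) := by
  rw [form_diag]
  exact Finset.sum_nonneg fun i _ =>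
    mul_nonneg (hz i) (form_idempotent_mul_self_nonneg (hc.idem i) y)

theorem form_diag_mul_self_pos (hz : ∀ i, 0 < z i) {y : V} (hy : y ≠ 0) :
    0 < form (diag c z) (y * y) := by
  have hsum : ∑ i, form (c i) (y * y) = form y y := by
    rw [← LinearMap.sum_apply, ← map_sum, hc.complete, ← form_assoc, one_mul]
  obtain ⟨i, hi, hpos⟩ : ∃ i ∈ Finset.univ, 0 < form (c i) (y * y) :=
    Finset.exists_lt_of_sum_lt <| by simpa [hsum] using form_pos y hy
  rw [form_diag]
  exact Finset.sum_pos' (fun j _ => mul_nonneg (hz j).le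
    (form_idempotent_mul_self_nonneg (hc.idem j) y)) ⟨i, hi, mul_pos (hz i) hpos⟩

end Frame

theorem form_nonneg {x y : V} (hx : IsSquare x) (hy : IsSquare y) : 0 ≤ form x y := by
  obtain ⟨u, rfl⟩ := hx
  obtain ⟨v, rfl⟩ := hy
  obtain ⟨n, c, z, hc, rfl⟩ := exists_eq_diag u
  rw [diag_mul_diag hc]
  exact form_diag_mul_self_nonneg hc (fun i => mul_self_nonneg (z i)) v

theorem tr_nonneg {x : V} (hx : IsSquare x) : 0 ≤ tr x :=
  form_nonneg hx ⟨1, (one_mul 1).symm⟩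

theorem isSquare_diag_iff {ι : Type*} [Fintype ι] {c : ι → V} (hc : IsCSOI c) {z : ι → ℝ} :
    IsSquare (diag c z) ↔ ∀ i, 0 ≤ z i := by
  refine ⟨fun h i => ?_, isSquare_diag hc⟩
  have h1 := form_nonneg h ⟨c i, (hc.idem i).symm⟩
  rw [form_diag_proj hc] at h1
  exact nonneg_of_mul_nonneg_left h1 (hc.tr_pos i)

theorem exists_eq_diag_of_isSquare {x : V} (hx : IsSquare x) :
    ∃ (n : ℕ) (c : Fin n → V) (z : Fin n → ℝ), IsCSOI c ∧ (∀ i, 0 ≤ z i) ∧ x = diag c z := by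
  obtain ⟨n, c, z, hc, rfl⟩ := exists_eq_diag x
  exact ⟨n, c, z, hc, (isSquare_diag_iff hc).1 hx, rfl⟩

theorem isSquare_of_forall_form_nonneg {x : V} (h : ∀ y : V, 0 ≤ form x (y * y)) :
    IsSquare x := by
  obtain ⟨n, c, z, hc, rfl⟩ := exists_eq_diag x
  refine isSquare_diag hc fun i => nonneg_of_mul_nonneg_left ?_ (hc.tr_pos i)
  rw [← form_diag_proj hc, ← hc.idem i]
  exact h (c i)

theorem exists_isJordanInverse_of_forall_form_pos {x : V}
    (h : ∀ y : V, y ≠ 0 → 0 < form x (y * y)) : ∃ y, IsJordanInverse x y := by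
  obtain ⟨n, c, z, hc, rfl⟩ := exists_eq_diag x
  refine ⟨diag c z⁻¹, isJordanInverse_diag hc <| funext fun i => mul_inv_cancel₀ ?_⟩
  have h1 := h (c i) (hc.ne_zero i)
  rw [hc.idem, form_diag_proj hc] at h1
  exact left_ne_zero_of_mul h1.ne'

/-- If `-m < 0` were an eigenvalue of `P_a g`, then `P_a (g + m a⁻²) = P_a g + m` would be singular,
although `g + m a⁻²` is positive definite. -/
theorem isSquare_quad_of_ne_zero {ι : Type*} [Fintype ι] {c : ι → V} (hc : IsCSOI c) {z : ι → ℝ}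
    (hz : ∀ i, z i ≠ 0) {g : V} (hg : IsSquare g) : IsSquare (quad (diag c z) g) := by
  have hinv : IsJordanInverse (diag c z) (diag c z⁻¹) :=
    isJordanInverse_diag hc <| funext fun i => mul_inv_cancel₀ (hz i)
  obtain ⟨n, d, w, hd, hw⟩ := exists_eq_diag (quad (diag c z) g)
  rw [hw]
  refine isSquare_diag hd fun i => ?_
  by_contra! hi
  obtain ⟨g', hg'⟩ : ∃ g', IsJordanInverse (g + (-w i) • diag c (z⁻¹ * z⁻¹)) g' := by
    refine exists_isJordanInverse_of_forall_form_pos fun y hy => ?_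
    have h1 := form_nonneg hg ⟨y, rfl⟩
    have h2 := form_diag_mul_self_pos hc (fun i => mul_self_pos.2 (inv_ne_zero (hz i))) hy
    rw [map_add, map_smul, LinearMap.add_apply, LinearMap.smul_apply, smul_eq_mul]
    exact add_pos_of_nonneg_of_pos h1 (mul_pos (neg_pos.2 hi) h2)
  have hshift : quad (diag c z) (g + (-w i) • diag c (z⁻¹ * z⁻¹)) = diag d (w + (-w i) • 1) := by
    rw [diag_add, diag_smul, diag_one hd, ← hw, ← hinv.2, diag_mul_diag hc]
    exact (map_add (quadRep _) _ _).trans (congrArg _ (map_smul (quadRep _) _ _))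
  have hkill : quad (diag d (w + (-w i) • 1)) (d i) = quad (diag d (w + (-w i) • 1)) 0 := by
    classical
    rw [← diag_single (𝕜 := ℝ) d i, quad_diag_diag hd, ← Pi.single_mul_right]
    simp [diag, quad]
  exact hd.ne_zero i ((hshift ▸ hinv.quad hg').quad_injective hkill)

theorem quad_add_smul_one (a g : V) (ε : ℝ) :
    quad (a + ε • 1) g = quad a g + (2 * ε) • (a * g) + (ε * ε) • g := by
  simp only [quad, add_mul, mul_add, smul_mul_assoc, mul_smul_comm, one_mul, mul_one]
  module

theorem isSquare_quad (a : V) {g : V} (hg : IsSquare g) : IsSquare (quad a g) := by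
  obtain ⟨n, c, z, hc, ha⟩ := exists_eq_diag a
  refine isSquare_of_forall_form_nonneg fun y => ?_
  let F (ε : ℝ) : ℝ := form (quad (a + ε • 1) g) (y * y)
  have hF : Tendsto F (𝓝[≠] 0) (𝓝 (form (quad a g) (y * y))) := by
    simp only [F, quad_add_smul_one, map_add, map_smul, LinearMap.add_apply, LinearMap.smul_apply]
    refine (Continuous.tendsto' (by fun_prop) _ _ (by simp)).mono_left nhdsWithin_le_nhds
  refine ge_of_tendsto hF ?_
  have hne : ∀ᶠ ε in 𝓝[≠] (0 : ℝ), ∀ i, z i + ε ≠ 0 := eventually_all.2 fun i => by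
    rcases eq_or_ne (z i) 0 with h | h
    · exact eventually_mem_nhdsWithin.mono fun ε hε => by simpa [h] using hε
    · exact ((continuous_const.add continuous_id).continuousAt.eventually_ne
        (by simpa using h)).filter_mono nhdsWithin_le_nhds
  filter_upwards [hne] with ε hε
  have hshift : a + ε • 1 = diag c (z + ε • 1) := by
    rw [diag_add, diag_smul, diag_one hc, ha]
  simp only [F, hshift]
  exact form_nonneg (isSquare_quad_of_ne_zero hc (fun i => by simpa using hε i) hg) ⟨y, rfl⟩

theorem isSquare_pow {x : V} (hx : IsSquare x) (t : ℝ) : IsSquare (pow x t) := by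
  obtain ⟨n, c, z, hc, hz, rfl⟩ := exists_eq_diag_of_isSquare hx
  rw [pow_diag hc]
  exact isSquare_diag hc fun i => Real.rpow_nonneg (hz i) t

theorem pow_pow {x : V} (hx : IsSquare x) (s t : ℝ) : pow (pow x s) t = pow x (s * t) := by
  obtain ⟨n, c, z, hc, hz, rfl⟩ := exists_eq_diag_of_isSquare hx
  simp only [pow_diag hc, Real.rpow_mul (hz _)]

theorem pow_one (x : V) : pow x 1 = x := by
  obtain ⟨n, c, z, hc, rfl⟩ := exists_eq_diag x
  simp only [pow_diag hc, Real.rpow_one]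

theorem pow_mul_self {x : V} (hx : IsSquare x) (t : ℝ) : pow x t * pow x t = pow x (t * 2) := by
  obtain ⟨n, c, z, hc, hz, rfl⟩ := exists_eq_diag_of_isSquare hx
  simp only [pow_diag hc, diag_mul_diag hc, Real.rpow_mul (hz _), Real.rpow_two, sq]
  rfl

theorem tr_pow_pos {x : V} (hx : IsSquare x) (hx0 : x ≠ 0) (t : ℝ) : 0 < tr (pow x t) := by
  obtain ⟨n, c, z, hc, hz, rfl⟩ := exists_eq_diag_of_isSquare hx
  obtain ⟨i, hi⟩ : ∃ i, z i ≠ 0 := by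
    by_contra! h
    exact hx0 (by simp [diag, h])
  rw [pow_diag hc, tr_diag]
  exact Finset.sum_pos' (fun j _ => mul_nonneg (Real.rpow_nonneg (hz j) t) (hc.tr_pos j).le)
    ⟨i, Finset.mem_univ i, mul_pos (Real.rpow_pos_of_pos ((hz i).lt_of_ne' hi) t) (hc.tr_pos i)⟩

end Cone

/-- The complexification of `V`, with elements `re + i im`. -/
@[ext]
structure Complexification (V : Type*) where
  re : V
  im : V

namespace Complexification

variable {V : Type*} [NonAssocCommRing V]

/-- The pair of the real and the imaginary part; it transports the additive structure. -/
def equivProd : Complexification V ≃ V × V where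
  toFun x := (x.re, x.im)
  invFun p := ⟨p.1, p.2⟩

instance : AddCommGroup (Complexification V) := equivProd.addCommGroup

instance : Mul (Complexification V) :=
  ⟨fun x y => ⟨x.re * y.re - x.im * y.im, x.re * y.im + x.im * y.re⟩⟩

instance : One (Complexification V) := ⟨⟨1, 0⟩⟩

@[simp] theorem re_zero : (0 : Complexification V).re = 0 := rfl
@[simp] theorem im_zero : (0 : Complexification V).im = 0 := rfl
@[simp] theorem re_add (x y : Complexification V) : (x + y).re = x.re + y.re := rfl
@[simp] theorem im_add (x y : Complexification V) : (x + y).im = x.im + y.im := rfl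
@[simp] theorem re_one : (1 : Complexification V).re = 1 := rfl
@[simp] theorem im_one : (1 : Complexification V).im = 0 := rfl
@[simp] theorem re_mul (x y : Complexification V) :
    (x * y).re = x.re * y.re - x.im * y.im := rfl
@[simp] theorem im_mul (x y : Complexification V) :
    (x * y).im = x.re * y.im + x.im * y.re := rfl

instance : NonAssocCommRing (Complexification V) :=
  { (inferInstance : AddCommGroup (Complexification V)) with
    left_distrib := fun x y z => by ext <;> simp [mul_add] <;> abel
    right_distrib := fun x y z => by ext <;> simp [add_mul] <;> abel
    zero_mul := fun x => by ext <;> simp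
    mul_zero := fun x => by ext <;> simp
    one_mul := fun x => by ext <;> simp
    mul_one := fun x => by ext <;> simp
    mul_comm := fun x y => by
      ext
      · simp only [re_mul, mul_comm]
      · simp only [im_mul, mul_comm x.re, mul_comm x.im, add_comm] }

variable [Module ℝ V]

instance : SMul ℂ (Complexification V) :=
  ⟨fun z x => ⟨z.re • x.re - z.im • x.im, z.re • x.im + z.im • x.re⟩⟩

@[simp] theorem re_smul (z : ℂ) (x : Complexification V) :
    (z • x).re = z.re • x.re - z.im • x.im := rfl
@[simp] theorem im_smul (z : ℂ) (x : Complexification V) :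
    (z • x).im = z.re • x.im + z.im • x.re := rfl

instance : Module ℂ (Complexification V) where
  one_smul x := by ext <;> simp
  mul_smul z w x := by ext <;> simp <;> module
  smul_zero z := by ext <;> simp
  smul_add z x y := by ext <;> simp <;> module
  add_smul z w x := by ext <;> simp <;> module
  zero_smul x := by ext <;> simp

/-- The inclusion of `V` into its complexification. -/
def ofReal : V →ₗ[ℝ] Complexification V where
  toFun x := ⟨x, 0⟩
  map_add' x y := by ext <;> simp
  map_smul' r x := by
    change (⟨r • x, 0⟩ : Complexification V) = (r : ℂ) • (⟨x, 0⟩ : Complexification V)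
    ext <;> simp [-Complex.coe_smul]

@[simp] theorem re_ofReal (x : V) : (ofReal x).re = x := rfl
@[simp] theorem im_ofReal (x : V) : (ofReal x).im = 0 := rfl

theorem ofReal_mul (x y : V) : ofReal (x * y) = ofReal x * ofReal y := by
  ext <;> simp

theorem ofReal_quad (x y : V) : ofReal (quad x y) = quad (ofReal x) (ofReal y) := by
  simp only [quad, map_sub, map_smul, ofReal_mul]

/-- The complex conjugation. -/
def conj : Complexification V →ₗ⋆[ℂ] Complexification V where
  toFun x := ⟨x.re, -x.im⟩
  map_add' x y := by ext <;> simp [add_comm]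
  map_smul' z x := by ext <;> simp; abel

@[simp] theorem re_conj (x : Complexification V) : (conj x).re = x.re := rfl
@[simp] theorem im_conj (x : Complexification V) : (conj x).im = -x.im := rfl

theorem conj_mul (x y : Complexification V) : conj (x * y) = conj x * conj y := by
  ext <;> simp; abel

theorem conj_quad (x y : Complexification V) : conj (quad x y) = quad (conj x) (conj y) := by
  simp only [quad, two_smul, map_sub, map_add, conj_mul]

variable {ι κ : Type*} [Fintype ι] [Fintype κ]

theorem ofReal_diag (c : ι → V) (z : ι → ℝ) :
    ofReal (diag c z) = diag (ofReal ∘ c) fun i => (z i : ℂ) := by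
  simp only [diag, map_sum, map_smul, Complex.coe_smul, Function.comp_apply]

theorem conj_diag (c : ι → V) (z : ι → ℂ) :
    conj (diag (ofReal ∘ c) z) = diag (ofReal ∘ c) fun i => starRingEnd ℂ (z i) := by
  have hconj (x : V) : conj (ofReal x) = ofReal x := by ext <;> simp
  simp only [diag, map_sum, LinearMap.map_smulₛₗ, Function.comp_apply, hconj]

theorem isCSOI_ofReal_comp {c : ι → V} (hc : IsCSOI c) : IsCSOI (ofReal ∘ c) where
  idem i := by simp only [Function.comp_apply, ← ofReal_mul, hc.idem]
  ne_zero i h := hc.ne_zero i (congrArg re h)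
  orth i j hij := by simp only [Function.comp_apply, ← ofReal_mul, hc.orth i j hij, map_zero]
  complete := by simp only [Function.comp_apply, ← map_sum, hc.complete]; rfl

section Jordan

variable [IsScalarTower ℝ V V] [SMulCommClass ℝ V V]

instance : IsScalarTower ℂ (Complexification V) (Complexification V) where
  smul_assoc z x y := by
    ext <;> simp [smul_mul_assoc, sub_mul, add_mul] <;> module

instance : SMulCommClass ℂ (Complexification V) (Complexification V) where
  smul_comm z x y := by
    ext <;> simp [mul_smul_comm, mul_sub, mul_add] <;> module

instance : IsScalarTower ℝ (Complexification V) (Complexification V) where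
  smul_assoc r x y := smul_assoc (r : ℂ) x y

instance : SMulCommClass ℝ (Complexification V) (Complexification V) where
  smul_comm r x y := smul_comm (r : ℂ) x y

end Jordan

instance [IsCommJordan V] : IsCommJordan (Complexification V) where
  lmul_comm_rmul_rmul x y := by
    have : IsAddTorsionFree V := .of_isTorsionFree ℝ V
    have h1 := jordan_linearized x.re x.re x.re y.re
    have h2 := jordan_linearized x.re x.re x.re y.im
    have h3 := jordan_linearized x.im x.im x.im y.re
    have h4 := jordan_linearized x.im x.im x.im y.im
    have h5 := jordan_linearized x.re x.re x.im y.re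
    have h6 := jordan_linearized x.re x.re x.im y.im
    have h7 := jordan_linearized x.im x.im x.re y.re
    have h8 := jordan_linearized x.im x.im x.re y.im
    ext <;> simp only [re_mul, im_mul, mul_add, mul_sub, add_mul, sub_mul] <;>
      simp only [mul_comm] at * <;> grind

variable [EuclideanJordanAlgebra V]

/-- The complex bilinear (not sesquilinear) extension of the inner product. -/
def cform : LinearMap.BilinForm ℂ (Complexification V) :=
  LinearMap.mk₂ ℂ (fun x y => ⟨form x.re y.re - form x.im y.im, form x.re y.im + form x.im y.re⟩)
    (fun x y z => by apply Complex.ext <;> simp <;> ring)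
    (fun a x y => by apply Complex.ext <;> simp <;> ring)
    (fun x y z => by apply Complex.ext <;> simp <;> ring)
    (fun a x y => by apply Complex.ext <;> simp <;> ring)

theorem cform_apply (x y : Complexification V) :
    cform x y = ⟨form x.re y.re - form x.im y.im, form x.re y.im + form x.im y.re⟩ := rfl

theorem cform_ofReal (x y : V) : cform (ofReal x) (ofReal y) = (form x y : ℂ) := by
  apply Complex.ext <;> simp [cform_apply]

theorem cform_comm (x y : Complexification V) : cform x y = cform y x := by
  apply Complex.ext <;> simp only [cform_apply, form_symm x.re, form_symm x.im, add_comm]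

theorem cform_mul_left_comm (x y z : Complexification V) :
    cform (x * y) z = cform y (x * z) := by
  rw [cform_apply, cform_apply]
  simp only [re_mul, im_mul, map_sub, map_add, LinearMap.sub_apply, LinearMap.add_apply,
    form_mul_left_comm]
  apply Complex.ext <;> simp only <;> ring

theorem cform_eq_cform_mul_one (x y : Complexification V) : cform x y = cform (x * y) 1 := by
  rw [cform_mul_left_comm, mul_one, cform_comm]

theorem cform_quad (x y z : Complexification V) : cform (quad x y) z = cform y (quad x z) := by
  simp only [quad, two_smul, map_sub, map_add, LinearMap.sub_apply, LinearMap.add_apply,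
    cform_mul_left_comm]

theorem re_cform_le_tr {g : V} (hg : IsSquare g) {w : Complexification V} (hw : w * conj w = 1) :
    (cform (ofReal g) w).re ≤ tr g := by
  have hsum : form g (w.re * w.re) + form g (w.im * w.im) = form g 1 := by
    rw [← map_add]
    congr 1
    simpa using congrArg re hw
  have h1 : 0 ≤ form g ((1 - w.re) * (1 - w.re)) := form_nonneg hg ⟨_, rfl⟩
  have h2 : 0 ≤ form g (w.im * w.im) := form_nonneg hg ⟨_, rfl⟩
  simp only [mul_sub, sub_mul, mul_one, one_mul, map_sub] at h1
  simp only [cform_apply, re_ofReal, im_ofReal, map_zero, LinearMap.zero_apply, sub_zero, tr]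
  linarith

theorem norm_cform_le_tr {g : V} (hg : IsSquare g) {w : Complexification V}
    (hw : w * conj w = 1) : ‖cform (ofReal g) w‖ ≤ tr g := by
  obtain ⟨a, ha, haw⟩ := Complex.exists_norm_eq_mul_self (cform (ofReal g) w)
  have hrot : a • w * conj (a • w) = 1 := by
    rw [LinearMap.map_smulₛₗ, smul_mul_smul_comm, hw, Complex.mul_conj', ha]
    simp
  have h := re_cform_le_tr hg hrot
  rwa [map_smul, smul_eq_mul, ← haw, Complex.ofReal_re] at h

theorem isJordanInverse_conj_diag {c : ι → V} (hc : IsCSOI c) {u : ι → ℂ} (hu : ∀ i, ‖u i‖ = 1) :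
    IsJordanInverse (diag (ofReal ∘ c) u) (conj (diag (ofReal ∘ c) u)) := by
  rw [conj_diag]
  refine isJordanInverse_diag (isCSOI_ofReal_comp hc) (funext fun i => ?_)
  rw [Pi.mul_apply, Complex.mul_conj', hu, Complex.ofReal_one, one_pow, Pi.one_apply]

theorem norm_cform_quad_diag_le_of_norm_eq_one {g : V} (hg : IsSquare g) {c : ι → V} {d : κ → V}
    (hc : IsCSOI c) (hd : IsCSOI d) {u : ι → ℂ} {v : κ → ℂ} (hu : ∀ i, ‖u i‖ = 1)
    (hv : ∀ i, ‖v i‖ = 1) :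
    ‖cform (ofReal g) (quad (diag (ofReal ∘ c) u) (diag (ofReal ∘ d) v))‖ ≤ tr g := by
  apply norm_cform_le_tr hg
  rw [conj_quad]
  exact ((isJordanInverse_conj_diag hc hu).quad (isJordanInverse_conj_diag hd hv)).mul_eq_one

end Complexification

section ComplexAnalysis

theorem norm_le_of_forall_norm_eq_one {ι : Type*} [Finite ι] {Φ : (ι → ℂ) → ℂ}
    (hΦ : Differentiable ℂ Φ) {M : ℝ} (hM : ∀ u : ι → ℂ, (∀ i, ‖u i‖ = 1) → ‖Φ u‖ ≤ M)
    {u : ι → ℂ} (hu : ∀ i, ‖u i‖ ≤ 1) : ‖Φ u‖ ≤ M := by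
  classical
  cases nonempty_fintype ι
  suffices h : ∀ (s : Finset ι) (u : ι → ℂ), (∀ i, ‖u i‖ ≤ 1) → (∀ i ∉ s, ‖u i‖ = 1) →
      ‖Φ u‖ ≤ M from
    h Finset.univ u hu (by simp)
  intro s
  induction s using Finset.induction_on with
  | empty => exact fun u _ hu => hM u fun i => hu i (Finset.notMem_empty i)
  | insert i s _ ih =>
    intro u hu hus
    have hline : Differentiable ℂ fun z => Φ (Function.update u i z) :=
      hΦ.comp fun z => (hasFDerivAt_update u z).differentiableAt
    have hmax := Complex.norm_le_of_forall_mem_frontier_norm_le (C := M) (z := u i)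
      (Metric.isBounded_ball (x := (0 : ℂ)) (r := 1)) hline.diffContOnCl (fun z hz => ?_) ?_
    · rwa [Function.update_eq_self] at hmax
    · rw [frontier_ball _ one_ne_zero, mem_sphere_zero_iff_norm] at hz
      refine ih _ (Function.forall_update_iff _ (p := fun _ w => ‖w‖ ≤ 1) |>.2
        ⟨hz.le, fun j _ => hu j⟩) fun j hj => ?_
      obtain rfl | hji := eq_or_ne j i
      · rw [Function.update_self, hz]
      · rw [Function.update_of_ne hji, hus j (by simp [hj, hji])]
    · rw [closure_ball _ one_ne_zero, mem_closedBall_zero_iff]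
      exact hu i

theorem le_of_le_rpow_mul_rpow {x y θ : ℝ} (hx : 0 ≤ x) (hy : 0 ≤ y) (hθ : 0 < θ)
    (h : x ≤ x ^ (1 - θ) * y ^ θ) : x ≤ y := by
  obtain rfl | hpos := hx.eq_or_lt
  · exact hy
  refine (Real.rpow_le_rpow_iff hx hy hθ).1
    (le_of_mul_le_mul_left ?_ (Real.rpow_pos_of_pos hpos (1 - θ)))
  rwa [← Real.rpow_add hpos, sub_add_cancel, Real.rpow_one]

open Complex.HadamardThreeLines in
theorem norm_comp_le_interp {E : Type*} [NormedAddCommGroup E] [NormedSpace ℂ E] [ProperSpace E]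
    {Φ : E → ℂ} (hΦ : Differentiable ℂ Φ) {γ : ℂ → E} (hγ : Differentiable ℂ γ)
    (hnorm : ∀ z, ‖γ z‖ = ‖γ z.re‖) {l u : ℝ} (hlu : l < u) {a b : ℝ}
    (ha : ∀ z : ℂ, z.re = l → ‖Φ (γ z)‖ ≤ a) (hb : ∀ z : ℂ, z.re = u → ‖Φ (γ z)‖ ≤ b)
    {x : ℝ} (hx : x ∈ Set.Icc l u) :
    ‖Φ (γ x)‖ ≤ a ^ (1 - (x - l) / (u - l)) * b ^ ((x - l) / (u - l)) := by
  have hbdd : BddAbove ((norm ∘ Φ ∘ γ) '' verticalClosedStrip l u) := by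
    have hline : Continuous fun y : ℝ => ‖γ y‖ :=
      (hγ.continuous.comp Complex.continuous_ofReal).norm
    obtain ⟨R, hR⟩ := (isCompact_Icc (a := l) (b := u)).bddAbove_image hline.continuousOn
    refine ((isCompact_closedBall (0 : E) R).bddAbove_image hΦ.continuous.norm.continuousOn).mono ?_
    rintro _ ⟨z, hz, rfl⟩
    refine ⟨γ z, ?_, rfl⟩
    rw [mem_closedBall_zero_iff, hnorm]
    exact hR ⟨z.re, hz, rfl⟩
  exact norm_le_interp_of_mem_verticalClosedStrip' (f := Φ ∘ γ) (z := (x : ℂ)) hlu hx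
    (hΦ.comp hγ).diffContOnCl hbdd ha hb

end ComplexAnalysis

section ComplexPower

variable {ι : Type*}

open Classical in
/-- The complex power `α ^ z` of a vector of non-negative reals, taken entrywise on the support of
`α` and `0` elsewhere. In contrast to `(0 : ℂ) ^ z`, this is an entire function of `z`. -/
noncomputable def cpowSupp (α : ι → ℝ) (z : ℂ) : ι → ℂ :=
  fun i => if α i = 0 then 0 else (α i : ℂ) ^ z

theorem cpowSupp_add (α : ι → ℝ) (z w : ℂ) :
    cpowSupp α (z + w) = cpowSupp α z * cpowSupp α w := by
  ext i
  by_cases h : α i = 0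
  · simp [cpowSupp, h]
  · simp [cpowSupp, h, Complex.cpow_add]

theorem differentiable_cpowSupp [Finite ι] (α : ι → ℝ) : Differentiable ℂ (cpowSupp α) := by
  cases nonempty_fintype ι
  refine differentiable_pi.2 fun i => ?_
  by_cases h : α i = 0
  · simp [cpowSupp, h]
  · simp only [cpowSupp, h, if_false]
    exact differentiable_id.const_cpow (Or.inl (by exact_mod_cast h))

variable {α : ι → ℝ} (hα : ∀ i, 0 ≤ α i)
include hα

theorem cpowSupp_ofReal {t : ℝ} (ht : t ≠ 0) : cpowSupp α t = fun i => ((α i ^ t : ℝ) : ℂ) := by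
  ext i
  by_cases h : α i = 0
  · simp [cpowSupp, h, Real.zero_rpow ht]
  · simp [cpowSupp, h, Complex.ofReal_cpow (hα i)]

theorem norm_cpowSupp_apply_congr {z w : ℂ} (h : z.re = w.re) (i : ι) :
    ‖cpowSupp α z i‖ = ‖cpowSupp α w i‖ := by
  by_cases hi : α i = 0
  · simp [cpowSupp, hi]
  · simp [cpowSupp, hi, Complex.norm_cpow_eq_rpow_re_of_pos ((hα i).lt_of_ne' hi), h]

theorem norm_cpowSupp_congr [Fintype ι] {z w : ℂ} (h : z.re = w.re) :
    ‖cpowSupp α z‖ = ‖cpowSupp α w‖ := by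
  have hi (i : ι) : ‖cpowSupp α z i‖₊ = ‖cpowSupp α w i‖₊ :=
    NNReal.eq (norm_cpowSupp_apply_congr hα h i)
  simp only [Pi.norm_def, hi]

theorem norm_cpowSupp_apply {z : ℂ} (hz : z.re ≠ 0) (i : ι) : ‖cpowSupp α z i‖ = α i ^ z.re := by
  rw [norm_cpowSupp_apply_congr hα (Complex.ofReal_re z.re).symm, cpowSupp_ofReal hα hz,
    Complex.norm_real, Real.norm_of_nonneg (Real.rpow_nonneg (hα i) _)]

theorem norm_cpowSupp_apply_le_one {z : ℂ} (hz : z.re = 0) (i : ι) : ‖cpowSupp α z i‖ ≤ 1 := by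
  rw [norm_cpowSupp_apply_congr hα (hz.trans Complex.zero_re.symm)]
  by_cases h : α i = 0 <;> simp [cpowSupp, h]

end ComplexPower

theorem differentiable_map_quad_diag {W E : Type*} [NonAssocCommRing W] [Module ℂ W]
    [IsScalarTower ℂ W W] [SMulCommClass ℂ W W] [NormedAddCommGroup E] [NormedSpace ℂ E]
    {ι κ : Type*} [Fintype ι] [Fintype κ] (f : W →ₗ[ℂ] ℂ) (c : ι → W) (d : κ → W)
    {u : E → ι → ℂ} {v : E → κ → ℂ} (hu : Differentiable ℂ u) (hv : Differentiable ℂ v) :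
    Differentiable ℂ fun x => f (quad (diag c (u x)) (diag d (v x))) := by
  simp only [quad, diag, two_smul, Finset.sum_mul, Finset.mul_sum, smul_mul_assoc, mul_smul_comm,
    map_sub, map_add, map_sum, map_smul, smul_eq_mul]
  fun_prop

namespace Complexification

section Contraction

variable {V : Type*} [NonAssocCommRing V] [Module ℝ V] [EuclideanJordanAlgebra V]
  {ι κ μ : Type*} [Fintype ι] [Fintype κ] [Fintype μ] {c : ι → V} {d : κ → V}
  (hc : IsCSOI c) (hd : IsCSOI d) {u : ι → ℂ} {v : κ → ℂ} (hu : ∀ i, ‖u i‖ ≤ 1)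
  (hv : ∀ i, ‖v i‖ ≤ 1)
include hc hd hu hv

theorem norm_cform_quad_diag_le {g : V} (hg : IsSquare g) :
    ‖cform (ofReal g) (quad (diag (ofReal ∘ c) u) (diag (ofReal ∘ d) v))‖ ≤ tr g := by
  refine norm_le_of_forall_norm_eq_one
    (differentiable_map_quad_diag (cform (ofReal g)) _ _ differentiable_id (differentiable_const v))
    (fun u' hu' => ?_) hu
  exact norm_le_of_forall_norm_eq_one
    (differentiable_map_quad_diag (cform (ofReal g)) _ _ (differentiable_const u')
      differentiable_id)
    (fun v' hv' => norm_cform_quad_diag_le_of_norm_eq_one hg hc hd hu' hv') hv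

theorem norm_cform_diag_quad_diag_le {e : μ → V} (he : ∀ l, IsSquare (e l)) (w : μ → ℂ) :
    ‖cform (diag (ofReal ∘ e) w) (quad (diag (ofReal ∘ c) u) (diag (ofReal ∘ d) v))‖ ≤
      ∑ l, ‖w l‖ * tr (e l) := by
  simp only [diag.eq_def _ w, map_sum, map_smul, LinearMap.sum_apply, LinearMap.smul_apply]
  refine norm_sum_le_of_le _ fun l _ => ?_
  rw [norm_smul]
  gcongr
  exact norm_cform_quad_diag_le hc hd hu hv (he l)

end Contraction

section Interpolant

variable {V : Type*} [NonAssocCommRing V] [Module ℝ V] [EuclideanJordanAlgebra V]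
  {ι κ μ : Type*} [Fintype ι] [Fintype κ] [Fintype μ] {c : ι → V} {d : κ → V} {e : μ → V}

theorem diag_cpowSupp_ofReal (hc : IsCSOI c) {α : ι → ℝ} (hα : ∀ i, 0 ≤ α i) {t : ℝ}
    (ht : t ≠ 0) : diag (ofReal ∘ c) (cpowSupp α t) = ofReal (pow (diag c α) t) := by
  rw [pow_diag hc, ofReal_diag, cpowSupp_ofReal hα ht]

theorem diag_cpowSupp_one (hc : IsCSOI c) {α : ι → ℝ} (hα : ∀ i, 0 ≤ α i) :
    diag (ofReal ∘ c) (cpowSupp α 1) = ofReal (diag c α) := by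
  simpa only [Complex.ofReal_one, pow_one] using diag_cpowSupp_ofReal hc hα one_ne_zero

/-- The entire function `⟨e(ξ)^{r-z}, P_{c(α)^z} d(β)^z⟩` that interpolates between the two sides of
the Araki–Lieb–Thirring inequality. -/
noncomputable def interpolant (c : ι → V) (d : κ → V) (e : μ → V) (α : ι → ℝ) (β : κ → ℝ)
    (ξ : μ → ℝ) (r : ℝ) (z : ℂ) : ℂ :=
  cform (diag (ofReal ∘ e) (cpowSupp ξ (r - z)))
    (quad (diag (ofReal ∘ c) (cpowSupp α z)) (diag (ofReal ∘ d) (cpowSupp β z)))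

variable (hc : IsCSOI c) (hd : IsCSOI d) (he : IsCSOI e) {α : ι → ℝ} {β : κ → ℝ} {ξ : μ → ℝ}
  (hα : ∀ i, 0 ≤ α i) (hβ : ∀ i, 0 ≤ β i) (hξ : ∀ i, 0 ≤ ξ i) {r : ℝ}

include hα hβ hξ in
theorem norm_interpolant_le_interp {a b : ℝ} (hr : 0 < r)
    (ha : ∀ z : ℂ, z.re = 0 → ‖interpolant c d e α β ξ r z‖ ≤ a)
    (hb : ∀ z : ℂ, z.re = r → ‖interpolant c d e α β ξ r z‖ ≤ b) {x : ℝ} (hx : x ∈ Set.Icc 0 r) :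
    ‖interpolant c d e α β ξ r x‖ ≤ a ^ (1 - x / r) * b ^ (x / r) := by
  let Φ (p : (μ → ℂ) × (ι → ℂ) × (κ → ℂ)) : ℂ := cform (diag (ofReal ∘ e) p.1)
    (quad (diag (ofReal ∘ c) p.2.1) (diag (ofReal ∘ d) p.2.2))
  have hΦ : Differentiable ℂ Φ := by
    have h (l : μ) := differentiable_map_quad_diag (cform (ofReal (e l))) (ofReal ∘ c) (ofReal ∘ d)
      (u := fun p : (μ → ℂ) × (ι → ℂ) × (κ → ℂ) => p.2.1) (v := fun p => p.2.2)
      (by fun_prop) (by fun_prop)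
    have hsum (p) : Φ p = ∑ l, p.1 l * cform (ofReal (e l))
        (quad (diag (ofReal ∘ c) p.2.1) (diag (ofReal ∘ d) p.2.2)) := by
      simp only [Φ, diag.eq_def _ p.1, map_sum, map_smul, LinearMap.sum_apply,
        LinearMap.smul_apply, smul_eq_mul, Function.comp_apply]
    rw [funext hsum]
    fun_prop
  let γ (z : ℂ) : (μ → ℂ) × (ι → ℂ) × (κ → ℂ) := (cpowSupp ξ (r - z), cpowSupp α z, cpowSupp β z)
  have hγ : Differentiable ℂ γ :=
    ((differentiable_cpowSupp ξ).comp (by fun_prop)).prodMk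
      ((differentiable_cpowSupp α).prodMk (differentiable_cpowSupp β))
  have hnorm (z : ℂ) : ‖γ z‖ = ‖γ z.re‖ := by
    simp only [γ, Prod.norm_def]
    rw [norm_cpowSupp_congr hα (Complex.ofReal_re z.re).symm,
      norm_cpowSupp_congr hβ (Complex.ofReal_re z.re).symm,
      norm_cpowSupp_congr hξ (w := r - (z.re : ℂ)) (by simp)]
  simpa [Φ, γ] using! norm_comp_le_interp hΦ hγ hnorm hr ha hb hx

include hc hd he hα hβ hξ in
theorem norm_interpolant_le_of_re_eq_zero (hr : 0 < r) {z : ℂ} (hz : z.re = 0) :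
    ‖interpolant c d e α β ξ r z‖ ≤ tr (pow (diag e ξ) r) := by
  refine (norm_cform_diag_quad_diag_le hc hd (norm_cpowSupp_apply_le_one hα hz)
    (norm_cpowSupp_apply_le_one hβ hz) (fun l => ⟨e l, (he.idem l).symm⟩) _).trans_eq ?_
  have hre : ((r : ℂ) - z).re = r := by simp [hz]
  simp only [pow_diag he, tr_diag, norm_cpowSupp_apply hξ (hre ▸ hr.ne'), hre]

include hc hd he hα hβ hξ in
theorem norm_interpolant_le_of_re_eq (hr : 0 < r) {z : ℂ} (hz : z.re = r) :
    ‖interpolant c d e α β ξ r z‖ ≤ tr (quad (pow (diag c α) r) (pow (diag d β) r)) := by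
  have hre : ((r : ℂ) - z).re = 0 := by simp [hz]
  have hre' : (z - r).re = 0 := by simp [hz]
  have hsplit (y : Complexification V) : quad (diag (ofReal ∘ c) (cpowSupp α z)) y =
      quad (ofReal (pow (diag c α) r)) (quad (diag (ofReal ∘ c) (cpowSupp α (z - r))) y) := by
    rw [← diag_cpowSupp_ofReal hc hα hr.ne', ← quad_diag_mul (isCSOI_ofReal_comp hc)
      (fun i => Complex.isSquare _), ← cpowSupp_add, add_sub_cancel]
  have hswap : interpolant c d e α β ξ r z =
      cform (diag (ofReal ∘ fun l => quad (pow (diag c α) r) (d l)) (cpowSupp β z))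
        (quad (diag (ofReal ∘ c) (cpowSupp α (z - r)))
          (diag (ofReal ∘ e) (cpowSupp ξ (r - z)))) := by
    rw [interpolant, ← cform_quad, hsplit, cform_quad, cform_comm, quad_diag_right]
    simp only [Function.comp_def, ofReal_quad]
  rw [hswap]
  refine (norm_cform_diag_quad_diag_le hc he (norm_cpowSupp_apply_le_one hα hre')
    (norm_cpowSupp_apply_le_one hξ hre) (fun l => isSquare_quad _ ⟨d l, (hd.idem l).symm⟩)
    _).trans_eq ?_
  rw [pow_diag hd, quad_diag_right, tr_diag]
  simp only [norm_cpowSupp_apply hβ (hz ▸ hr.ne'), hz]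

include hc hd he hα hβ hξ in
theorem interpolant_one (hr : r ≠ 0) (h : quad (diag c α) (diag d β) = diag e ξ) :
    interpolant c d e α β ξ r 1 = tr (pow (diag e ξ) r) := by
  rw [interpolant, diag_cpowSupp_one hc hα, diag_cpowSupp_one hd hβ, ← ofReal_quad, h,
    ← diag_cpowSupp_one he hξ, cform_eq_cform_mul_one,
    diag_mul_diag (isCSOI_ofReal_comp he), ← cpowSupp_add, sub_add_cancel,
    diag_cpowSupp_ofReal he hξ hr]
  exact cform_ofReal _ 1

end Interpolant

end Complexification

open Complexification

theorem tr_pow_quad_le {V : Type*} [NonAssocCommRing V] [Module ℝ V] [EuclideanJordanAlgebra V]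
    {a b : V} (ha : IsSquare a) (hb : IsSquare b) {r : ℝ} (hr : 1 ≤ r) :
    tr (pow (quad a b) r) ≤ tr (quad (pow a r) (pow b r)) := by
  have hr0 : 0 < r := one_pos.trans_le hr
  obtain ⟨n, c, α, hc, hα, rfl⟩ := exists_eq_diag_of_isSquare ha
  obtain ⟨m, d, β, hd, hβ, rfl⟩ := exists_eq_diag_of_isSquare hb
  have hsq := isSquare_quad (diag c α) hb
  obtain ⟨k, e, ξ, he, hξ, hquad⟩ := exists_eq_diag_of_isSquare hsq
  have hS := tr_nonneg (isSquare_pow hsq r)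
  have hQ := tr_nonneg (isSquare_quad (pow (diag c α) r) (isSquare_pow hb r))
  have h := norm_interpolant_le_interp hα hβ hξ hr0
    (fun _ => norm_interpolant_le_of_re_eq_zero hc hd he hα hβ hξ hr0)
    (fun _ => norm_interpolant_le_of_re_eq hc hd he hα hβ hξ hr0) ⟨zero_le_one, hr⟩
  rw [Complex.ofReal_one, interpolant_one hc hd he hα hβ hξ hr0.ne' hquad, ← hquad,
    Complex.norm_real, Real.norm_of_nonneg hS] at h
  exact le_of_le_rpow_mul_rpow hS hQ (one_div_pos.2 hr0) h

section Renyi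

variable {V : Type*} [NonAssocCommRing V] [Module ℝ V] [EuclideanJordanAlgebra V] {ρ σ : V}
  (hσ : IsSquare σ)
include hσ

theorem quad_pow_neg_quad_pow {t : ℝ} (ht : t ≠ 0) (y : V) :
    quad (pow σ (-t)) (quad (pow σ t) y) = quad (supp σ) y := by
  obtain ⟨n, c, z, hc, hz, rfl⟩ := exists_eq_diag_of_isSquare hσ
  rw [pow_diag hc, pow_diag hc, supp, fn_diag hc,
    ← quad_diag_mul hc fun i => Real.isSquare_iff.2 (Real.rpow_nonneg (hz i) _)]
  congr 2
  ext i
  by_cases hi : z i = 0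
  · simp [hi, ht]
  · simp [hi, ← Real.rpow_add ((hz i).lt_of_ne' hi)]

theorem quad_pow_ne_zero (hρ0 : ρ ≠ 0) (h : SuppLE ρ σ) {t : ℝ} (ht : t ≠ 0) :
    quad (pow σ t) ρ ≠ 0 := by
  intro hzero
  have hidem : supp σ * supp σ = supp σ := by
    obtain ⟨n, c, z, hc, rfl⟩ := exists_eq_diag σ
    rw [supp, fn_diag hc, diag_mul_diag hc]
    congr 1
    ext i
    simp
  have hquad : quad (supp σ) ρ = ρ := by
    rw [quad, hidem, h, h, two_smul, add_sub_cancel_right]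
  rw [← quad_pow_neg_quad_pow hσ ht, hzero, ← quadRep_apply, map_zero] at hquad
  exact hρ0 hquad.symm

theorem tr_pow_sandwich_le (hρ : IsSquare ρ) {s : ℝ} (hs : 0 < s) :
    tr (pow (quad (pow σ (-s / (2 * (1 + s)))) ρ) (1 + s)) ≤ tr (pow ρ (1 + s) * pow σ (-s)) := by
  refine (tr_pow_quad_le (isSquare_pow hσ _) hρ (by linarith)).trans_eq ?_
  rw [tr_quad, pow_pow hσ, pow_mul_self hσ]
  congr 3
  field_simp

end Renyi

end EuclideanJordanAlgebra

open EuclideanJordanAlgebra in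
theorem corollary4p1_general {V : Type*} [NonAssocCommRing V] [Module ℝ V]
    [EuclideanJordanAlgebra V] {ρ σ : V} (hρ : IsSquare ρ) (hρ0 : ρ ≠ 0) (hσ : IsSquare σ)
    {s : ℝ} (hs : 0 < s) : petzRenyi s ρ σ ≥ sandwichedRenyi s ρ σ := by
  rw [petzRenyi, sandwichedRenyi]
  split_ifs with h
  · have ht : -s / (2 * (1 + s)) ≠ 0 := div_ne_zero (by linarith) (by linarith)
    have hpos := tr_pow_pos (isSquare_quad _ hρ) (quad_pow_ne_zero hσ hρ0 h ht) (1 + s)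
    have hle := tr_pow_sandwich_le hσ hρ hs
    exact EReal.coe_le_coe <| by gcongr
  · exact le_rfl

theorem corollary4p1 {V : Type*} [NonAssocCommRing V] [Module ℝ V] [EuclideanJordanAlgebra V]
    (ρ σ : V) (hρ : EuclideanJordanAlgebra.IsState ρ) (hσ : EuclideanJordanAlgebra.IsState σ)
    (s : ℝ) (hs : 0 < s) :
    EuclideanJordanAlgebra.petzRenyi s ρ σ ≥ EuclideanJordanAlgebra.sandwichedRenyi s ρ σ :=
  corollary4p1_general hρ.1 (by rintro rfl; simpa [EuclideanJordanAlgebra.tr] using hρ.2) hσ.1 hs
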